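/- Let $F$ be an ordered field. A subring $I\subseteq F$ is an \emph{integer part} of $F$ if $I$ has no element strictly between $0$ and $1$ and for every $x\in F$ there is a (necessarily unique) $a\in I$, written $\lfloor x\rfloor$, with $a\le x<a+1$. For $\alpha\in F$ put $N_\alpha=\{\lfloor n\alpha\rfloor : n\in I,\ n\ge 0\}$, and let $I^{\ge 0}=\{n\in I: n\ge 0\}$. An element of $F$ is \emph{rational} if it lies in $\operatorname{Frac}(I)\subseteq F$, the fraction field of $I$, and \emph{irrational} otherwise. In the language $\{+,-,\cdot,0,1,\le\}$ of ordered rings, an $E_1$-formula is a formula $\exists z_1\cdots\exists z_k\,\bigl(\bigwedge_i 0\le z_i\le t(\bar x)\ \wedge\ \varphi(\bar x,\bar z)\bigr)$ with $k \ge 0$, $t$ a term and $\varphi$ quantifier-free. A discretely ordered ring $I$ is a model of $IE_1$ if, for every $E_1$-formula $\psi(\bar x,y)$ and all parameters $\bar x$ in $I$, from $\psi(\bar x,0)$ and $\forall y\ge 0\,(\psi(\bar x,y)\to\psi(\bar x,y+1))$ it follows that $\forall y\ge 0\ \psi(\bar x,y)$. **Theorem.** Let $I$ be an integer part of an ordered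 field $F$ and suppose that $I\models IE_1$. Then the following hold. (C) If $\alpha,\beta\in F$ are positive irrationals such that $a\alpha^{-1}+b\beta^{-1}=c$ for some $a,b,c\in I$ with $ab<0$ and $c\ne 0$, then $N_\alpha\cap N_\beta$ is a cofinal subset of $I^{\ge 0}$. (D) If $\alpha,\beta\in F$ are positive irrationals such that $a\alpha^{-1}+b\beta^{-1}=c$ for some $a,b,c\in I$ with $a,b>0$, $c>1$ and $\gcd(a,b,c)=1$ (that is, every common divisor of $a,b,c$ in $I$ is a unit), then $N_\alpha\cap N_\beta$ is a cofinal subset of $I^{\ge 0}$. (F') If $\rho,\sigma\in F$ are rational, $\rho>1$, $\sigma>1$ and $N_\rho\subseteq N_\sigma$, then there exist $a,b\in I^{\ge 0}$ such that $a\rho^{-1}+b(1-\sigma^{-1})=1$. -/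

import Mathlib

noncomputable section

namespace SkolemBang

open FirstOrder FirstOrder.Language

/-- The first-order language `{+, -, ·, 0, 1, ≤}` of ordered rings. -/
abbrev orderedRingLang : FirstOrder.Language.{0, 0} :=
  FirstOrder.Language.sum FirstOrder.Language.ring FirstOrder.Language.order

/-- The standard interpretation of the language of ordered rings in an ordered ring. -/
@[reducible]
def orderedRingStructure (R : Type*) [CommRing R] [LinearOrder R] :
    orderedRingLang.Structure R :=
  letI : FirstOrder.Language.ring.Structure R := (FirstOrder.Ring.compatibleRingOfRing R).toStructure
  letI : FirstOrder.Language.order.Structure R := FirstOrder.Language.orderStructure R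
  FirstOrder.Language.sumStructure FirstOrder.Language.ring FirstOrder.Language.order R

/-- The constant symbol `0` as a term. -/
def zeroTerm {α : Type*} : orderedRingLang.Term α :=
  Constants.term (Sum.inl FirstOrder.ringFunc.zero)

/-- The formula `∃ z₁ ⋯ zₖ (0 ≤ zᵢ ≤ t(x̄) for all i, and φ(x̄, z̄))`. The free variables `x̄` are
indexed by `α`, and the term `t` involves only these. -/
def boundedEx {α : Type*} {k : ℕ} (t : orderedRingLang.Term α)
    (φ : orderedRingLang.Formula (α ⊕ Fin k)) : orderedRingLang.Formula α :=
  Formula.iExs (Fin k)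
    (Formula.iInf (fun i : Fin k =>
        Term.le zeroTerm (Term.var (Sum.inl (Sum.inr i))) ⊓
          Term.le (Term.var (Sum.inl (Sum.inr i))) (t.relabel (fun a => Sum.inl (Sum.inl a))))
      ⊓ φ)

/-- The class `E₁` of bounded existential formulas: a block of bounded existential quantifiers
in front of an open (quantifier-free) formula. -/
def IsE1 {α : Type*} (ψ : orderedRingLang.Formula α) : Prop :=
  ∃ (k : ℕ) (t : orderedRingLang.Term α) (φ : orderedRingLang.Formula (α ⊕ Fin k)),
    BoundedFormula.IsQF φ ∧ ψ = boundedEx t φ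

/-- `R ⊨ φ(x̄, y)`, where the parameters `x̄` are indexed by `Fin n` and `y` is the
distinguished variable. -/
def Holds {R : Type*} [CommRing R] [LinearOrder R] {n : ℕ}
    (φ : orderedRingLang.Formula (Fin n ⊕ Unit)) (x : Fin n → R) (y : R) : Prop :=
  letI := orderedRingStructure R
  φ.Realize (Sum.elim x (fun _ => y))

/-- A discretely ordered ring: there is no element strictly between `0` and `1`. -/
def IsDiscretelyOrdered (R : Type*) [CommRing R] [LinearOrder R] [IsStrictOrderedRing R] : Prop :=
  ∀ x : R, ¬ (0 < x ∧ x < 1)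

/-- `R` is a model of `IE₁`: a discretely ordered ring satisfying induction, on its non-negative
part, for all `E₁` formulas with parameters. -/
structure ModelsIE1 (R : Type*) [CommRing R] [LinearOrder R] [IsStrictOrderedRing R] : Prop where
  discrete : IsDiscretelyOrdered R
  induction : ∀ (n : ℕ) (φ : orderedRingLang.Formula (Fin n ⊕ Unit)), IsE1 φ →
    ∀ x : Fin n → R,
      Holds φ x 0 ∧ (∀ y : R, 0 ≤ y → Holds φ x y → Holds φ x (y + 1)) →
        ∀ y : R, 0 ≤ y → Holds φ x y

/-- Semantics of a bounded existential block. -/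
theorem realize_boundedEx {R : Type*} [CommRing R] [LinearOrder R] {α : Type*} {k : ℕ}
    (t : orderedRingLang.Term α) (φ : orderedRingLang.Formula (α ⊕ Fin k)) (v : α → R) :
    letI := orderedRingStructure R
    (boundedEx t φ).Realize v ↔
      ∃ z : Fin k → R, (∀ i, 0 ≤ z i ∧ z i ≤ t.realize v) ∧ φ.Realize (Sum.elim v z) := by
  let _ := orderedRingStructure R
  have hle : ∀ (s u : orderedRingLang.Term ((α ⊕ Fin k) ⊕ Fin 0)) (w : α ⊕ Fin k → R),
      Formula.Realize (Term.le s u) w ↔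
        s.realize (Sum.elim w default) ≤ u.realize (Sum.elim w default) :=
    fun s u w => BoundedFormula.realize_rel₂
  unfold boundedEx
  rw [Formula.realize_iExs]
  refine exists_congr fun z => ?_
  rw [Formula.realize_inf, Formula.realize_iInf]
  refine and_congr_left fun _ => forall_congr' fun i => ?_
  rw [Formula.realize_inf, hle, hle, Term.realize_relabel]
  rfl

section Beatty

variable {F : Type*} [Field F] [LinearOrder F] [IsStrictOrderedRing F]

/-- `a` is the integer part of `x` with respect to `I`. -/
def IsFloor (I : Subring F) (x : F) (a : I) : Prop :=
  (a : F) ≤ x ∧ x < (a : F) + 1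

/-- The subring `I` is an integer part of the ordered field `F`. -/
structure IsIntegerPart (I : Subring F) : Prop where
  discrete : IsDiscretelyOrdered I
  exists_floor : ∀ x : F, ∃ a : I, IsFloor I x a

/-- The integer part of an element is unique. -/
theorem IsIntegerPart.existsUnique_floor {I : Subring F} (hI : IsIntegerPart I) (x : F) :
    ∃! a : I, IsFloor I x a := by
  obtain ⟨a, ha⟩ := hI.exists_floor x
  have key : ∀ b c : I, IsFloor I x b → IsFloor I x c → ¬ b < c := by
    intro b c hb hc hbc
    refine hI.discrete (c - b) ⟨sub_pos.2 hbc, ?_⟩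
    have h : (c : F) < b + 1 := hc.1.trans_lt hb.2
    have h' : c < b + 1 := by exact_mod_cast h
    exact sub_lt_iff_lt_add'.2 h'
  exact ⟨a, ha, fun b hb => le_antisymm (not_lt.1 (key a b ha hb)) (not_lt.1 (key b a hb ha))⟩

/-- `N_α = {⌊nα⌋ : n ∈ I, n ≥ 0}`. -/
def N (I : Subring F) (α : F) : Set I :=
  {a | ∃ n : I, 0 ≤ n ∧ IsFloor I ((n : F) * α) a}

/-- `x` is rational with respect to `I`, i.e. `x ∈ Frac(I) ⊆ F`. -/
def IsRational (I : Subring F) (x : F) : Prop :=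
  ∃ p q : I, q ≠ 0 ∧ x = (p : F) / (q : F)

/-- `S` is a cofinal subset of `I^{≥ 0}`. -/
def IsCofinalNonneg (I : Subring F) (S : Set I) : Prop :=
  S ⊆ Set.Ici 0 ∧ IsCofinalFor (Set.Ici 0) S

/-- `gcd(a, b, c) = 1`: every common divisor is a unit. -/
def GcdEqOne {R : Type*} [CommRing R] (a b c : R) : Prop :=
  ∀ d : R, d ∣ a → d ∣ b → d ∣ c → IsUnit d

end Beatty

end SkolemBang

end

/-! Induction is needed for one `E₁` statement only: a fraction `a / m` with `a ≥ 0`, `m > 0` lies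
between consecutive Farey fractions of every order. Passing to mediants proves it. Order `m` yields
Bézout's identity (`exists_gcd`). Order `n`, applied to `⌊n²x⌋ / n²`, yields Dirichlet's theorem,
and hence, for irrational `x > 0`, density of the values `s - t x` with `t` arbitrarily large
(`exists_sub_mul_mem`).

An element `m ≥ 0` lies in `N_α` as soon as `0 ≤ n - m/α < 1/α` for some `n`. In (C) and (D) the
linear relation ties `k - m/β` to `n - m/α` along a suitable family of `m`, so both membership
conditions reduce to hitting one nonempty open interval, which density allows.

For (F') write `ρ = q/p`, `σ = w/v` in lowest terms, `u = w - v`, `d = gcd(q, w)`. The conclusion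
follows if `d` is a nonnegative combination of `p` and `u`. Otherwise there are `0 ≤ i < p` and `1 ≤
j ≤ u` with `d ∣ iu - jp`, and the Chinese remainder theorem gives `m ≥ 0` with `q ∣ mp + i` and `w
∣ mu + j`. The first divisibility puts `m` in `N_ρ`, the second keeps it out of `N_σ`. -/

noncomputable section

namespace SkolemBang

open FirstOrder FirstOrder.Language

/-! ### Farey neighbours as an `E₁` formula -/

section FareyFormula

/-- Sum of two terms. -/
def addTerm {α : Type*} (s t : orderedRingLang.Term α) : orderedRingLang.Term α :=
  Functions.apply₂ (L := orderedRingLang) (Sum.inl FirstOrder.ringFunc.add) s t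

/-- Product of two terms. -/
def mulTerm {α : Type*} (s t : orderedRingLang.Term α) : orderedRingLang.Term α :=
  Functions.apply₂ (L := orderedRingLang) (Sum.inl FirstOrder.ringFunc.mul) s t

/-- The constant symbol `1` as a term. -/
def oneTerm {α : Type*} : orderedRingLang.Term α :=
  Constants.term (Sum.inl FirstOrder.ringFunc.one)

/-- The atomic formula `s ≤ t`. -/
def leFormula {α : Type*} (s t : orderedRingLang.Term α) : orderedRingLang.Formula α :=
  Term.le (s.relabel Sum.inl) (t.relabel Sum.inl)

theorem isQF_leFormula {α : Type*} (s t : orderedRingLang.Term α) :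
    BoundedFormula.IsQF (leFormula s t) :=
  (BoundedFormula.IsAtomic.rel _ _).isQF

variable {R : Type*} [CommRing R] [LinearOrder R]

theorem realize_addTerm {α : Type*} (s t : orderedRingLang.Term α) (v : α → R) :
    letI := orderedRingStructure R
    (addTerm s t).realize v = s.realize v + t.realize v := by
  let _ := orderedRingStructure R
  exact Term.realize_functions_apply₂

theorem realize_mulTerm {α : Type*} (s t : orderedRingLang.Term α) (v : α → R) :
    letI := orderedRingStructure R
    (mulTerm s t).realize v = s.realize v * t.realize v := by
  let _ := orderedRingStructure R
  exact Term.realize_functions_apply₂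

theorem realize_oneTerm {α : Type*} (v : α → R) :
    letI := orderedRingStructure R
    (oneTerm : orderedRingLang.Term α).realize v = 1 := by
  let _ := orderedRingStructure R
  exact Term.realize_constants

theorem realize_leFormula {α : Type*} (s t : orderedRingLang.Term α) (v : α → R) :
    letI := orderedRingStructure R
    (leFormula s t).Realize v ↔ s.realize v ≤ t.realize v := by
  let _ := orderedRingStructure R
  have h : (leFormula s t).Realize v ↔ (s.relabel Sum.inl).realize (Sum.elim v default) ≤
      (t.relabel Sum.inl).realize (Sum.elim v (default : Fin 0 → R)) :=
    BoundedFormula.realize_rel₂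
  rw [h, Term.realize_relabel, Term.realize_relabel]
  rfl

/-- The variables of the Farey formula: parameters `a`, `m`, the induction variable `y`, and
the quantified variables. -/
abbrev FareyVar := (Fin 2 ⊕ Unit) ⊕ Fin 4

/-- A parameter of the Farey formula. -/
def fareyParam (i : Fin 2) : orderedRingLang.Term FareyVar := Term.var (Sum.inl (Sum.inl i))

/-- The induction variable of the Farey formula, plus one. -/
def fareyBound : orderedRingLang.Term FareyVar :=
  addTerm (Term.var (Sum.inl (Sum.inr ()))) oneTerm

/-- A quantified variable of the Farey formula. -/
def fareyVar (i : Fin 4) : orderedRingLang.Term FareyVar := Term.var (Sum.inr i)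

/-- The matrix of the Farey formula: `p / q` and `p' / q'` are adjacent fractions with
denominators at most `y + 1 < q + q'` and `p / q ≤ a / m < p' / q'`. -/
def fareyMatrix : orderedRingLang.Formula FareyVar :=
  leFormula oneTerm (fareyVar 1) ⊓
  (leFormula oneTerm (fareyVar 3) ⊓
  (leFormula (fareyVar 1) fareyBound ⊓
  (leFormula (fareyVar 3) fareyBound ⊓
  (leFormula (addTerm fareyBound oneTerm) (addTerm (fareyVar 1) (fareyVar 3)) ⊓
  (leFormula (mulTerm (fareyVar 0) (fareyParam 1)) (mulTerm (fareyParam 0) (fareyVar 1)) ⊓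
  (leFormula (addTerm (mulTerm (fareyParam 0) (fareyVar 3)) oneTerm)
    (mulTerm (fareyVar 2) (fareyParam 1)) ⊓
  (leFormula (mulTerm (fareyVar 2) (fareyVar 1))
      (addTerm (mulTerm (fareyVar 0) (fareyVar 3)) oneTerm) ⊓
   leFormula (addTerm (mulTerm (fareyVar 0) (fareyVar 3)) oneTerm)
      (mulTerm (fareyVar 2) (fareyVar 1)))))))))

theorem isQF_fareyMatrix : BoundedFormula.IsQF fareyMatrix := by
  unfold fareyMatrix
  repeat' first | exact isQF_leFormula _ _ | apply BoundedFormula.IsQF.inf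

/-- A bound for the quantified variables of the Farey formula: `(a + 1) (y + 1) + 1`. -/
def fareyQuantBound : orderedRingLang.Term (Fin 2 ⊕ Unit) :=
  addTerm (mulTerm (addTerm (Term.var (Sum.inl 0)) oneTerm)
    (addTerm (Term.var (Sum.inr ())) oneTerm)) oneTerm

/-- `p / q` and `p' / q'` are consecutive in the Farey sequence of order `y + 1` and
`p / q ≤ a / m < p' / q'`. -/
structure IsFareyPair (a m y p q p' q' : R) : Prop where
  one_le : 1 ≤ q
  one_le' : 1 ≤ q'
  le : q ≤ y + 1
  le' : q' ≤ y + 1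
  le_add : y + 1 + 1 ≤ q + q'
  left : p * m ≤ a * q
  right : a * q' + 1 ≤ p' * m
  det : p' * q = p * q' + 1

theorem holds_fareyFormula (x : Fin 2 → R) (y : R) :
    Holds (boundedEx fareyQuantBound fareyMatrix) x y ↔
      ∃ z : Fin 4 → R, (∀ i, 0 ≤ z i ∧ z i ≤ (x 0 + 1) * (y + 1) + 1) ∧
        IsFareyPair (x 0) (x 1) y (z 0) (z 1) (z 2) (z 3) := by
  let _ := orderedRingStructure R
  unfold Holds
  rw [realize_boundedEx]
  refine exists_congr fun z => and_congr ?_ ?_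
  · refine forall_congr' fun i => and_congr_right fun _ => ?_
    simp only [fareyQuantBound, realize_addTerm, realize_mulTerm, realize_oneTerm,
      Term.realize_var, Sum.elim_inl, Sum.elim_inr]
  · simp only [fareyMatrix, Formula.realize_inf, realize_leFormula, fareyBound, fareyVar,
      fareyParam, realize_addTerm, realize_mulTerm, realize_oneTerm, Term.realize_var,
      Sum.elim_inl, Sum.elim_inr]
    constructor
    · rintro ⟨h1, h2, h3, h4, h5, h6, h7, h8, h9⟩
      exact ⟨h1, h2, h3, h4, h5, h6, h7, le_antisymm h8 h9⟩
    · rintro ⟨h1, h2, h3, h4, h5, h6, h7, h8⟩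
      exact ⟨h1, h2, h3, h4, h5, h6, h7, h8.le, h8.ge⟩

end FareyFormula

/-! ### Existence of Farey neighbours by `E₁` induction -/

section Discrete

variable {R : Type*} [CommRing R] [LinearOrder R] [IsStrictOrderedRing R]

theorem IsDiscretelyOrdered.add_one_le (h : IsDiscretelyOrdered R) {a b : R} (hab : a < b) :
    a + 1 ≤ b := by
  by_contra! hc
  exact h (b - a) ⟨sub_pos.2 hab, by linarith⟩

theorem IsDiscretelyOrdered.one_le (h : IsDiscretelyOrdered R) {a : R} (ha : 0 < a) : 1 ≤ a := by
  simpa using h.add_one_le ha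

/-- These bounds allow the existential quantifiers over Farey pairs to be bounded by a term in `a`
and `y`. The bound on `p'` comes from `p'q = pq' + 1 ≤ aqq' + 1`. -/
theorem IsFareyPair.bounds {a m y p q p' q' : R} (h : IsFareyPair a m y p q p' q')
    (ha : 0 ≤ a) (hm : 1 ≤ m) (hp : 0 ≤ p) :
    0 ≤ p' ∧ p ≤ (a + 1) * (y + 1) + 1 ∧ q ≤ (a + 1) * (y + 1) + 1 ∧
      p' ≤ (a + 1) * (y + 1) + 1 ∧ q' ≤ (a + 1) * (y + 1) + 1 := by
  obtain ⟨h1, h2, h3, h4, h5, h6, h7, h8⟩ := h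
  have hy : 0 ≤ y := by linarith
  have haq : 0 ≤ a * q := mul_nonneg ha (by linarith)
  have haq' : 0 ≤ a * q' := mul_nonneg ha (by linarith)
  have hay : a * q ≤ a * (y + 1) := mul_le_mul_of_nonneg_left h3 ha
  have hay' : a * q' ≤ a * (y + 1) := mul_le_mul_of_nonneg_left h4 ha
  have hpa : p ≤ a * q := le_trans (le_mul_of_one_le_right hp hm) h6
  have hp' : p' ≤ a * q' + 1 := by
    by_contra! hc
    have e1 : (a * q' + 1) * q < p' * q := mul_lt_mul_of_pos_right hc (by linarith)
    have e2 : p * q' ≤ a * q * q' := mul_le_mul_of_nonneg_right hpa (by linarith)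
    nlinarith
  have hp0 : 0 ≤ p' := by
    by_contra! hc
    have : p' * m < 0 := mul_neg_of_neg_of_pos hc (by linarith)
    linarith
  refine ⟨hp0, ?_, ?_, ?_, ?_⟩ <;> linarith

/-- In a model of `IE₁`, every fraction with an integer part lies between consecutive Farey
fractions of any order. -/
theorem ModelsIE1.exists_isFareyPair (h : ModelsIE1 R) {a m f : R} (hf : 0 ≤ f) (ha : 0 ≤ a)
    (hm : 0 < m) (hfa : f * m ≤ a) (haf : a < (f + 1) * m) {y : R} (hy : 0 ≤ y) :
    ∃ p q p' q' : R, IsFareyPair a m y p q p' q' := by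
  have hm1 : 1 ≤ m := h.discrete.one_le hm
  have key : ∀ y : R, Holds (boundedEx fareyQuantBound fareyMatrix) ![a, m] y ↔
      ∃ p q p' q' : R, 0 ≤ p ∧ IsFareyPair a m y p q p' q' := by
    intro y
    rw [holds_fareyFormula]
    constructor
    · rintro ⟨z, hz, hF⟩
      exact ⟨z 0, z 1, z 2, z 3, (hz 0).1, hF⟩
    · rintro ⟨p, q, p', q', hp, hF⟩
      obtain ⟨b0, b1, b2, b3, b4⟩ := hF.bounds ha hm1 hp
      refine ⟨![p, q, p', q'], fun i => ?_, hF⟩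
      have hq := hF.one_le
      have hq' := hF.one_le'
      fin_cases i
      · exact ⟨hp, b1⟩
      · exact ⟨(zero_le_one.trans hq : 0 ≤ q), b2⟩
      · exact ⟨b0, b3⟩
      · exact ⟨(zero_le_one.trans hq' : 0 ≤ q'), b4⟩
  have hind := h.induction 2 _ ⟨4, fareyQuantBound, fareyMatrix, isQF_fareyMatrix, rfl⟩
    ![a, m] ⟨?_, ?_⟩ y hy
  · obtain ⟨p, q, p', q', -, hF⟩ := (key y).1 hind
    exact ⟨p, q, p', q', hF⟩
  · have := h.discrete.add_one_le haf
    rw [key]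
    refine ⟨f, 1, f + 1, 1, hf, ?_, ?_, ?_, ?_, ?_, ?_, ?_, ?_⟩ <;> linarith
  · intro y hy hF
    obtain ⟨p, q, p', q', hp, h1, h2, h3, h4, h5, h6, h7, h8⟩ := (key y).1 hF
    rw [key]
    -- If `q + q'` exceeds the new order `y + 2`, the pair stays consecutive. Otherwise `q + q' = y
    -- + 2`, and the mediant replaces the endpoint on its side of `a / m`.
    obtain hlt | hge := lt_or_ge (y + 1 + 1) (q + q')
    · have := h.discrete.add_one_le hlt
      refine ⟨p, q, p', q', hp, ?_, ?_, ?_, ?_, ?_, ?_, ?_, ?_⟩ <;> linarith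
    · have hp' : 0 ≤ p' := (IsFareyPair.bounds ⟨h1, h2, h3, h4, h5, h6, h7, h8⟩ ha hm1 hp).1
      obtain hle | hlt := le_or_gt ((p + p') * m) (a * (q + q'))
      · refine ⟨p + p', q + q', p', q', by linarith, ?_, ?_, ?_, ?_, ?_, ?_, ?_, ?_⟩ <;> linarith
      · have := h.discrete.add_one_le hlt
        refine ⟨p, q, p + p', q + q', hp, ?_, ?_, ?_, ?_, ?_, ?_, ?_, ?_⟩ <;> linarith

end Discrete

/-! ### Bézout, Dirichlet and density -/

section IntegerPart

variable {F : Type*} [Field F] [LinearOrder F] [IsStrictOrderedRing F] {I : Subring F}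

theorem IsIntegerPart.exists_div (hI : IsIntegerPart I) (a : I) {m : I} (hm : 0 < m) :
    ∃ f : I, f * m ≤ a ∧ a < (f + 1) * m := by
  obtain ⟨f, h1, h2⟩ := hI.exists_floor ((a : F) / m)
  have hm' : (0 : F) < m := by exact_mod_cast hm
  rw [le_div_iff₀ hm'] at h1
  rw [div_lt_iff₀ hm'] at h2
  exact ⟨f, by exact_mod_cast h1, by exact_mod_cast h2⟩

theorem IsIntegerPart.exists_ge (hI : IsIntegerPart I) (x : F) : ∃ n : I, 0 < n ∧ x ≤ n := by
  obtain ⟨f, -, h2⟩ := hI.exists_floor x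
  refine ⟨max (f + 1) 1, lt_max_of_lt_right one_pos, ?_⟩
  have : ((f + 1 : I) : F) ≤ (max (f + 1) 1 : I) := by exact_mod_cast le_max_left _ _
  push_cast at this
  linarith

theorem exists_isFareyPair (hI : IsIntegerPart I) (hIE : ModelsIE1 I) {a m y : I} (ha : 0 ≤ a)
    (hm : 0 < m) (hy : 0 ≤ y) : ∃ p q p' q' : I, IsFareyPair a m y p q p' q' := by
  obtain ⟨f, h1, h2⟩ := hI.exists_div a hm
  refine hIE.exists_isFareyPair ?_ ha hm h1 h2 hy
  by_contra! hf
  have := hI.discrete.add_one_le hf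
  have := mul_nonpos_of_nonpos_of_nonneg this hm.le
  linarith

/-- In Farey order `m` the lower neighbour must equal `a / m` itself, which puts it in lowest terms;
the determinant relation is then the Bézout identity. -/
theorem exists_gcd_of_pos (hI : IsIntegerPart I) (hIE : ModelsIE1 I) {a m : I} (ha : 0 ≤ a)
    (hm : 0 < m) : ∃ g a' m' : I, a = g * a' ∧ m = g * m' ∧ IsCoprime a' m' := by
  have hm1 := hI.discrete.one_le hm
  obtain ⟨p, q, p', q', h1, h2, h3, h4, h5, h6, h7, h8⟩ :=
    exists_isFareyPair hI hIE ha hm (y := m - 1) (by linarith)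
  have hsum : q * (p' * m - a * q') + q' * (a * q - p * m) = m := by linear_combination m * h8
  have he : a * q - p * m = 0 := by
    -- If both determinants in `hsum` were at least `1`, the sum would be at least `q + q' ≥ m + 1`.
    by_contra hne
    have he1 := hI.discrete.one_le (lt_of_le_of_ne (sub_nonneg.2 h6) (Ne.symm hne))
    have i1 : q * 1 ≤ q * (p' * m - a * q') :=
      mul_le_mul_of_nonneg_left (by linarith) (by linarith)
    have i2 : q' * 1 ≤ q' * (a * q - p * m) := mul_le_mul_of_nonneg_left he1 (by linarith)
    linarith
  refine ⟨p' * m - a * q', p, q, ?_, ?_, -q', p', ?_⟩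
  · linear_combination p' * he - a * h8
  · linear_combination -hsum + q' * he
  · linear_combination h8

/-- The integer part is a Bézout domain: any two elements have a greatest common divisor
that is a linear combination of them. -/
theorem exists_gcd (hI : IsIntegerPart I) (hIE : ModelsIE1 I) (a m : I) :
    ∃ g a' m' : I, 0 ≤ g ∧ a = g * a' ∧ m = g * m' ∧ IsCoprime a' m' := by
  obtain ⟨g, a', m', h1, h2, h3⟩ :
      ∃ g a' m' : I, a = g * a' ∧ m = g * m' ∧ IsCoprime a' m' := by
    have hpos : ∀ b n : I, 0 < n → ∃ g b' n' : I, b = g * b' ∧ n = g * n' ∧ IsCoprime b' n' := by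
      intro b n hn
      obtain hb | hb := le_total 0 b
      · exact exists_gcd_of_pos hI hIE hb hn
      · obtain ⟨g, b', n', h1, h2, h3⟩ := exists_gcd_of_pos hI hIE (neg_nonneg.2 hb) hn
        exact ⟨g, -b', n', by rw [mul_neg, ← h1, neg_neg], h2, h3.neg_left⟩
    obtain hm | hm | hm := lt_trichotomy m 0
    · obtain ⟨g, b', n', h1, h2, h3⟩ := hpos a (-m) (neg_pos.2 hm)
      exact ⟨g, b', -n', h1, by rw [mul_neg, ← h2, neg_neg], h3.neg_right⟩
    · exact ⟨a, 1, 0, by simp, by simp [hm], isCoprime_one_left⟩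
    · exact hpos a m hm
  obtain hg | hg := le_total 0 g
  · exact ⟨g, a', m', hg, h1, h2, h3⟩
  · exact ⟨-g, -a', -m', neg_nonneg.2 hg, by rw [neg_mul_neg, h1], by rw [neg_mul_neg, h2],
      h3.neg_neg⟩

theorem exists_combination_eq_one (hI : IsIntegerPart I) (hIE : ModelsIE1 I) {a b c : I}
    (h : GcdEqOne a b c) : ∃ n k m : I, a * n + b * k - c * m = 1 := by
  obtain ⟨g, a', b', -, ha, hb, u, v, huv⟩ := exists_gcd hI hIE a b
  -- Here `e` is a gcd of `a`, `b`, `c`, hence a unit.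
  obtain ⟨e, g', c', -, hg, hc, s, t, hst⟩ := exists_gcd hI hIE g c
  obtain ⟨w, hw⟩ := (h e ⟨g' * a', by rw [ha, hg, mul_assoc]⟩ ⟨g' * b', by rw [hb, hg, mul_assoc]⟩
    ⟨c', hc⟩).exists_right_inv
  refine ⟨w * s * u, w * s * v, -(w * t), ?_⟩
  subst hb ha hc hg
  linear_combination w * s * e * g' * huv + w * e * hst + hw

/-- Dirichlet's approximation theorem. -/
theorem exists_abs_mul_sub_lt (hI : IsIntegerPart I) (hIE : ModelsIE1 I) {x ε : F} (hx : 0 < x)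
    (hε : 0 < ε) : ∃ s t : I, 1 ≤ t ∧ |(t : F) * x - s| < ε := by
  -- The error will be at most `3 / n`: `1 / n` from truncating `n²x` to `f`, and `2 / n` from the
  -- Farey approximation of `f / n²`.
  obtain ⟨n, hn, hnε⟩ := hI.exists_ge (4 / ε)
  have hn' : (0 : F) < n := by exact_mod_cast hn
  have hn1' : (1 : F) ≤ n := by exact_mod_cast hI.discrete.one_le hn
  obtain ⟨f, hf1, hf2⟩ := hI.exists_floor (((n * n : I) : F) * x)
  have hnn : 0 < n * n := mul_pos hn hn
  have hnn' : (0 : F) < ((n * n : I) : F) := by exact_mod_cast hnn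
  have hf0 : 0 ≤ f := by
    by_contra! hf
    have h1 := hI.discrete.add_one_le hf
    have h1' : (f : F) + 1 ≤ 0 := by exact_mod_cast h1
    have : 0 < ((n * n : I) : F) * x := mul_pos hnn' hx
    linarith
  have h4 : 4 ≤ ε * n := by rwa [div_le_iff₀' hε] at hnε
  obtain ⟨p, q, p', q', h1, h2, h3, h4', h5, h6, h7, h8⟩ :=
    exists_isFareyPair hI hIE hf0 hnn (y := n - 1) (by linarith [hI.discrete.one_le hn])
  have hq : (1 : F) ≤ q := by exact_mod_cast h1
  have hq' : (1 : F) ≤ q' := by exact_mod_cast h2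
  have hqn : (q : F) ≤ n := by exact_mod_cast (by linarith : q ≤ n)
  have hqn' : (q' : F) ≤ n := by exact_mod_cast (by linarith : q' ≤ n)
  have hsum : (n : F) + 1 ≤ q + q' := by exact_mod_cast (by linarith : n + 1 ≤ q + q')
  have hl : (p : F) * (n * n) ≤ f * q := by exact_mod_cast h6
  have hr : (f : F) * q' + 1 ≤ p' * (n * n) := by exact_mod_cast h7
  have hd : (p' : F) * q = p * q' + 1 := by exact_mod_cast h8
  push_cast at hf1 hf2
  -- the approximation errors for `f / n ^ 2`, multiplied by the complementary denominators
  have hsum2 : (q : F) * (p' * (n * n) - f * q') + q' * (f * q - p * (n * n)) = n * n := by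
    linear_combination ((n : F) * n) * hd
  have close : ∀ s t : F, 1 ≤ t → t ≤ n → |f * t - s * (n * n)| * n ≤ 2 * (n * n) →
      |t * x - s| < ε := by
    intro s t ht1 htn hst
    have e1 : |f * t - s * (n * n)| ≤ 2 * n := by
      by_contra! hc
      have := mul_lt_mul_of_pos_right hc hn'
      linarith
    have e2 : |(n * n) * (t * x - s)| ≤ 3 * n := by
      have : (n : F) * n * (t * x - s) = t * (n * n * x - f) + (f * t - s * (n * n)) := by ring
      rw [this]
      refine (abs_add_le _ _).trans ?_
      have : |t * (n * n * x - f)| ≤ n := by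
        rw [abs_of_nonneg (mul_nonneg (by linarith) (by linarith))]
        calc t * (n * n * x - f) ≤ t * 1 := mul_le_mul_of_nonneg_left (by linarith) (by linarith)
          _ ≤ n := by linarith
      linarith
    rw [abs_mul, abs_of_pos (mul_pos hn' hn')] at e2
    by_contra! hc
    have e3 : (n : F) * n * ε ≤ n * n * |t * x - s| :=
      mul_le_mul_of_nonneg_left hc (mul_pos hn' hn').le
    have e4 : 4 * (n : F) ≤ ε * n * n := mul_le_mul_of_nonneg_right h4 hn'.le
    linarith
  -- Take the fraction with the smaller denominator. The other denominator is at least `n / 2`, so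
  -- `hsum2` bounds the determinant of the chosen fraction by `2n`.
  obtain hh | hh := le_total (q : F) q'
  · refine ⟨p, q, h1, close _ _ hq hqn ?_⟩
    have e0 : 0 ≤ (f : F) * q - p * (n * n) := by linarith
    rw [abs_of_nonneg e0]
    have e1 : 0 ≤ (q : F) * (p' * (n * n) - f * q') := mul_nonneg (by linarith) (by linarith)
    have e2 : ((f : F) * q - p * (n * n)) * n ≤ (f * q - p * (n * n)) * (2 * q') :=
      mul_le_mul_of_nonneg_left (by linarith) e0
    linarith
  · refine ⟨p', q', h2, close _ _ hq' hqn' ?_⟩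
    have e0 : 0 ≤ (p' : F) * (n * n) - f * q' := by linarith
    rw [abs_sub_comm, abs_of_nonneg e0]
    have e1 : 0 ≤ (q' : F) * (f * q - p * (n * n)) := mul_nonneg (by linarith) (by linarith)
    have e2 : ((p' : F) * (n * n) - f * q') * n ≤ (p' * (n * n) - f * q') * (2 * q) :=
      mul_le_mul_of_nonneg_left (by linarith) e0
    linarith

theorem IsIntegerPart.exists_mul_mem (hI : IsIntegerPart I) {δ l : F} (hδ : 0 < δ) :
    ∃ j : I, l < j * δ ∧ j * δ ≤ l + δ := by
  obtain ⟨f, h1, h2⟩ := hI.exists_floor (l / δ)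
  rw [le_div_iff₀ hδ] at h1
  rw [div_lt_iff₀ hδ] at h2
  refine ⟨f + 1, ?_, ?_⟩ <;> push_cast <;> linarith

/-- For irrational `x`, the elements `s - t x` with `s, t ∈ I` and `t` large are dense. -/
theorem exists_sub_mul_mem (hI : IsIntegerPart I) (hIE : ModelsIE1 I) {x : F} (hx : 0 < x)
    (hirr : ¬ IsRational I x) {l r : F} (hlr : l < r) (B : I) :
    ∃ s t : I, B ≤ t ∧ l < s - t * x ∧ s - t * x < r := by
  -- The step `δ = |t x - s|` is nonzero by irrationality and shorter than the interval, so its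
  -- multiples cannot jump over any translate of it. Translating by a large `k ∈ I`, absorbed into
  -- `s`, forces the multiplier `j` above `C`, hence `j t ≥ B`.
  obtain ⟨s, t, ht, hst⟩ := exists_abs_mul_sub_lt hI hIE hx (sub_pos.2 hlr)
  have htF : (1 : F) ≤ t := by exact_mod_cast ht
  have hne : (t : F) * x - s ≠ 0 := by
    intro h0
    refine hirr ⟨s, t, (zero_lt_one.trans_le ht).ne', ?_⟩
    rw [eq_div_iff (by linarith)]
    linarith
  obtain ⟨C, hC, hBC⟩ := hI.exists_ge (B : F)
  have hC' : (0 : F) < C := by exact_mod_cast hC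
  have large : ∀ {j : I} {δ : F}, 0 < δ → (C : F) * δ < j * δ → B ≤ j * t := by
    intro j δ hδ hj
    have hCj : (C : F) < j := lt_of_mul_lt_mul_right hj hδ.le
    have : (B : F) ≤ j * t := by
      calc (B : F) ≤ j * 1 := by linarith
        _ ≤ j * t := mul_le_mul_of_nonneg_left htF (by linarith)
    exact_mod_cast this
  obtain hneg | hpos := lt_or_gt_of_ne hne
  · rw [abs_of_neg hneg] at hst
    have hδ : 0 < (s : F) - t * x := by linarith
    obtain ⟨k, -, hk⟩ := hI.exists_ge (C * (s - t * x) - l)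
    obtain ⟨j, h1, h2⟩ := hI.exists_mul_mem (l := l + k) hδ
    refine ⟨j * s - k, j * t, large hδ (by linarith), ?_, ?_⟩ <;> push_cast <;> linarith
  · rw [abs_of_pos hpos] at hst
    obtain ⟨k, -, hk⟩ := hI.exists_ge (C * (t * x - s) + r)
    obtain ⟨j, h1, h2⟩ := hI.exists_mul_mem (l := k - r) hpos
    refine ⟨j * s + k, j * t, large hpos (by linarith), ?_, ?_⟩ <;> push_cast <;> linarith

end IntegerPart

/-! ### Facts (C) and (D): irrational slopes -/

section Irrational

variable {F : Type*} [Field F] [LinearOrder F] {I : Subring F}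

theorem not_isRational_inv {x : F} (hx0 : 0 < x) (hx : ¬ IsRational I x) :
    ¬ IsRational I x⁻¹ := by
  rintro ⟨p, q, -, hpq⟩
  refine hx ⟨q, p, ?_, by rw [← inv_inv x, hpq, inv_div]⟩
  rintro rfl
  rw [ZeroMemClass.coe_zero, zero_div] at hpq
  exact hx0.ne' (inv_eq_zero.1 hpq)

variable [IsStrictOrderedRing F]

theorem mem_N_of_sub_mem {α : F} (hα : 0 < α) {m n : I} (hm : 0 ≤ m)
    (h1 : 0 ≤ (n : F) - m * α⁻¹) (h2 : (n : F) - m * α⁻¹ < α⁻¹) : m ∈ N I α := by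
  have hm' : (0 : F) ≤ m := by exact_mod_cast hm
  have hn : (0 : F) ≤ n := by linarith [mul_nonneg hm' (inv_pos.2 hα).le]
  have e : (n : F) * α - m = (n - m * α⁻¹) * α := by field_simp
  have e1 : 0 ≤ ((n : F) - m * α⁻¹) * α := mul_nonneg h1 hα.le
  have e2 : ((n : F) - m * α⁻¹) * α < α⁻¹ * α := mul_lt_mul_of_pos_right h2 hα
  rw [inv_mul_cancel₀ hα.ne'] at e2
  exact ⟨n, by exact_mod_cast hn, by linarith, by linarith⟩

theorem IsDiscretelyOrdered.nonneg_of_mem_N (h : IsDiscretelyOrdered I) {α : F} (hα : 0 < α)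
    {m : I} (hm : m ∈ N I α) : 0 ≤ m := by
  obtain ⟨n, hn, -, h2⟩ := hm
  have hn' : (0 : F) ≤ n := by exact_mod_cast hn
  have h0 : (0 : F) < m + 1 := (mul_nonneg hn' hα.le).trans_lt h2
  by_contra! hlt
  have : (m : F) + 1 ≤ 0 := by exact_mod_cast h.add_one_le hlt
  linarith

theorem isCofinalNonneg_inter_N (hI : IsIntegerPart I) {α β : F} (hα : 0 < α) (hβ : 0 < β)
    (h : ∀ B : I, 0 ≤ B → ∃ m n k : I, B ≤ m ∧ 0 ≤ (n : F) - m * α⁻¹ ∧ (n : F) - m * α⁻¹ < α⁻¹ ∧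
      0 ≤ (k : F) - m * β⁻¹ ∧ (k : F) - m * β⁻¹ < β⁻¹) :
    IsCofinalNonneg I (N I α ∩ N I β) := by
  refine ⟨fun m hm => hI.discrete.nonneg_of_mem_N hα hm.1, fun B hB => ?_⟩
  obtain ⟨m, n, k, hBm, h1, h2, h3, h4⟩ := h B hB
  exact ⟨m, ⟨mem_N_of_sub_mem hα (le_trans hB hBm) h1 h2,
    mem_N_of_sub_mem hβ (le_trans hB hBm) h3 h4⟩, hBm⟩

/-- Put `θ = s - t/α` and `m = -bt`. The relation gives `n - m/α = -bθ` and `k - m/β = aθ` for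
suitable `n`, `k`, so every small enough `θ > 0` works. -/
theorem isCofinalNonneg_of_pos_of_neg (hI : IsIntegerPart I) (hIE : ModelsIE1 I) {α β : F}
    (hα : 0 < α) (hβ : 0 < β) (hirr : ¬ IsRational I α) {a b c : I}
    (h : (a : F) * α⁻¹ + (b : F) * β⁻¹ = (c : F)) (ha : 0 < a) (hb : b < 0) :
    IsCofinalNonneg I (N I α ∩ N I β) := by
  refine isCofinalNonneg_inter_N hI hα hβ fun B hB => ?_
  have ha' : (0 : F) < a := by exact_mod_cast ha
  have hb' : (0 : F) < -b := by exact_mod_cast neg_pos.2 hb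
  have hx := inv_pos.2 hα
  have hy := inv_pos.2 hβ
  obtain ⟨s, t, hBt, h1, h2⟩ := exists_sub_mul_mem hI hIE hx (not_isRational_inv hα hirr)
    (lt_min (div_pos hx hb') (div_pos hy ha')) B
  obtain ⟨h3, h4⟩ := lt_min_iff.1 h2
  rw [lt_div_iff₀' hb'] at h3
  rw [lt_div_iff₀' ha'] at h4
  have e1 : ((-b * s : I) : F) - (-b * t : I) * α⁻¹ = -b * (s - t * α⁻¹) := by push_cast; ring
  have e2 : ((a * s - t * c : I) : F) - (-b * t : I) * β⁻¹ = a * (s - t * α⁻¹) := by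
    push_cast
    linear_combination (t : F) * h
  refine ⟨-b * t, -b * s, a * s - t * c, ?_, ?_, ?_, ?_, ?_⟩
  · exact hBt.trans (le_mul_of_one_le_left (hB.trans hBt) (hI.discrete.one_le (neg_pos.2 hb)))
  · rw [e1]; exact (mul_pos hb' h1).le
  · rwa [e1]
  · rw [e2]; exact (mul_pos ha' h1).le
  · rwa [e2]

/-- If `an + bk - cm = 1`, then `φ = n - m/α` and `ψ = k - m/β` satisfy `aφ + bψ = 1`. Adding `(bs,
ct - as, bt)` to `(n, k, m)` preserves the equation, and density steers `φ`. -/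
theorem isCofinalNonneg_of_pos_of_pos (hI : IsIntegerPart I) (hIE : ModelsIE1 I) {α β : F}
    (hα : 0 < α) (hβ : 0 < β) (hirr : ¬ IsRational I α) {a b c : I}
    (h : (a : F) * α⁻¹ + (b : F) * β⁻¹ = (c : F)) (ha : 0 < a) (hb : 0 < b) (hc : 1 < c)
    (hgcd : GcdEqOne a b c) : IsCofinalNonneg I (N I α ∩ N I β) := by
  refine isCofinalNonneg_inter_N hI hα hβ fun B hB => ?_
  have ha' : (0 : F) < a := by exact_mod_cast ha
  have hb' : (0 : F) < b := by exact_mod_cast hb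
  have hc' : (1 : F) < c := by exact_mod_cast hc
  have hx := inv_pos.2 hα
  have hy := inv_pos.2 hβ
  obtain ⟨n, k, m, hnkm⟩ := exists_combination_eq_one hI hIE hgcd
  have hnkm' : (a : F) * n + b * k - c * m = 1 := by exact_mod_cast hnkm
  -- This is the range of `φ` where also `0 < ψ < 1/β`, rewritten using `aφ + bψ = 1`. It is
  -- nonempty because `c > 1` and `a/α < c`.
  have hlr : max 0 (α⁻¹ - (c - 1) / a) < min α⁻¹ (1 / a) := by
    refine max_lt (lt_min hx (one_div_pos.2 ha')) (lt_min ?_ ?_)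
    · linarith [div_pos (sub_pos.2 hc') ha']
    · rw [sub_lt_iff_lt_add, ← add_div, lt_div_iff₀' ha']
      linarith [mul_pos hb' hy]
  obtain ⟨s, t, hBt, h1, h2⟩ := exists_sub_mul_mem hI hIE hx (not_isRational_inv hα hirr)
    (div_lt_div_of_pos_right (sub_lt_sub_right hlr ((n : F) - m * α⁻¹)) hb') (max (B - m) 0)
  obtain ⟨hBt, ht0⟩ := max_le_iff.1 hBt
  rw [div_lt_iff₀' hb', sub_lt_iff_lt_add] at h1
  rw [lt_div_iff₀' hb', lt_sub_iff_add_lt] at h2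
  obtain ⟨h3, h4⟩ := max_lt_iff.1 h1
  obtain ⟨h5, h6⟩ := lt_min_iff.1 h2
  have e1 : ((n + b * s : I) : F) - (m + b * t : I) * α⁻¹ =
      b * (s - t * α⁻¹) + (n - m * α⁻¹) := by push_cast; ring
  have e2 : (b : F) * (((k + c * t - a * s : I) : F) - (m + b * t : I) * β⁻¹) =
      1 - (b * (s - t * α⁻¹) + (n - m * α⁻¹)) * a := by
    push_cast
    linear_combination hnkm' - ((m : F) + b * t) * h
  rw [lt_div_iff₀ ha'] at h6
  rw [sub_lt_comm, lt_div_iff₀ ha'] at h4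
  refine ⟨m + b * t, n + b * s, k + c * t - a * s, ?_, ?_, ?_, ?_, ?_⟩
  · have := le_mul_of_one_le_left ht0 (hI.discrete.one_le hb)
    linarith
  · rw [e1]; exact h3.le
  · rwa [e1]
  · refine nonneg_of_mul_nonneg_right ?_ hb'
    rw [e2]
    linarith
  · refine lt_of_mul_lt_mul_left ?_ hb'.le
    rw [e2]
    linarith

end Irrational

/-! ### Fact (F'): rational slopes -/

section Rational

variable {F : Type*} [Field F] [LinearOrder F] [IsStrictOrderedRing F] {I : Subring F}

theorem IsRational.exists_isCoprime (hI : IsIntegerPart I) (hIE : ModelsIE1 I) {ρ : F}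
    (hρ : IsRational I ρ) (h0 : 0 < ρ) :
    ∃ p q : I, 0 < p ∧ 0 < q ∧ IsCoprime p q ∧ ρ = (q : F) / p := by
  obtain ⟨q, p, hp, h⟩ := hρ
  obtain ⟨g, q', p', -, hq', hp', hcop⟩ := exists_gcd hI hIE q p
  have hg : (g : F) ≠ 0 := by
    intro hg0
    obtain rfl : g = 0 := Subtype.ext hg0
    exact hp (by rw [hp', zero_mul])
  have hρ' : ρ = (q' : F) / p' := by
    rw [h, hq', hp', Subring.coe_mul, Subring.coe_mul, mul_div_mul_left _ _ hg]
  rw [hρ'] at h0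
  obtain ⟨h1, h2⟩ | ⟨h1, h2⟩ := div_pos_iff.1 h0
  · exact ⟨p', q', by exact_mod_cast h2, by exact_mod_cast h1, hcop.symm, hρ'⟩
  · refine ⟨-p', -q', ?_, ?_, hcop.symm.neg_neg, ?_⟩
    · exact neg_pos.2 (by exact_mod_cast h2)
    · exact neg_pos.2 (by exact_mod_cast h1)
    · rw [hρ']; push_cast; rw [neg_div_neg_eq]

/-- Either `d` is a nonnegative combination of `p` and `u`, or `i u - j p` is a multiple of `d`
for some `0 ≤ i < p` and `1 ≤ j ≤ u`. -/
theorem exists_nonneg_combination_or (hI : IsIntegerPart I) (hIE : ModelsIE1 I) {p u d : I}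
    (hp : 0 < p) (hu : 0 < u) (hd : 0 < d) :
    (∃ a b : I, 0 ≤ a ∧ 0 ≤ b ∧ a * p + b * u = d) ∨
      ∃ i j : I, 0 ≤ i ∧ i < p ∧ 1 ≤ j ∧ j ≤ u ∧ d ∣ i * u - j * p := by
  obtain ⟨g, p', u', hg, hp', hu', s, t, hst⟩ := exists_gcd hI hIE p u
  have hp'0 : 0 < p' := pos_of_mul_pos_right (hp' ▸ hp) hg
  have hu'0 : 0 < u' := pos_of_mul_pos_right (hu' ▸ hu) hg
  obtain hg1 | hg1 := lt_or_ge 1 g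
  -- With a common factor `g > 1`, cancelling it gives `p'u - u'p = 0` with `p' < p`.
  · refine Or.inr ⟨p', u', hp'0.le, ?_, hI.discrete.one_le hu'0, ?_, 0, ?_⟩
    · rw [hp']; exact lt_mul_of_one_lt_left hp'0 hg1
    · rw [hu']; exact le_mul_of_one_le_left hu'0.le hg1.le
    · rw [hp', hu']; ring
  · have hg0 : 0 < g := lt_of_le_of_ne hg (by rintro rfl; simp [hp'] at hp)
    obtain rfl : g = 1 := le_antisymm hg1 (hI.discrete.one_le hg0)
    rw [one_mul] at hp' hu'
    subst hp' hu'
    -- Reduce the coefficient of `u` in `d = (ds)p + (dt)u` to `i` in `[0, p)`. If the coefficient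
    -- of `p` becomes `-j < 0`, then `jp = iu - d < pu` forces `j ≤ u`.
    obtain ⟨k, hk1, hk2⟩ := hI.exists_div (d * t) hp
    obtain hj | hj := le_or_gt 0 (d * s + k * u)
    · exact Or.inl ⟨d * s + k * u, d * t - k * p, hj, by linarith, by linear_combination d * hst⟩
    · refine Or.inr ⟨d * t - k * p, -(d * s + k * u), by linarith, by linarith,
        hI.discrete.one_le (neg_pos.2 hj), ?_, 1, by linear_combination d * hst⟩
      refine le_of_mul_le_mul_right ?_ hp
      have := mul_lt_mul_of_pos_right (show d * t - k * p < p by linarith) hu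
      linarith [show -(d * s + k * u) * p = (d * t - k * p) * u - d by
        linear_combination -d * hst]

/-- Simultaneous linear congruences with compatible right-hand sides have a nonnegative
solution. -/
theorem exists_nonneg_dvd_mul_add (hI : IsIntegerPart I) {p u d q w i j : I} (hd : 0 < d)
    (hq : 0 < q) (hw : 0 < w) (hpq : IsCoprime p (d * q)) (huw : IsCoprime u (d * w))
    (hqw : IsCoprime q w) (h : d ∣ i * u - j * p) :
    ∃ m : I, 0 ≤ m ∧ d * q ∣ m * p + i ∧ d * w ∣ m * u + j := by
  obtain ⟨p', q', hp'⟩ := id hpq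
  obtain ⟨u', w', hu'⟩ := id huw
  have hcop : IsCoprime d (p * u) :=
    IsCoprime.mul_right hpq.of_mul_right_left.symm huw.of_mul_right_left.symm
  -- The two congruences ask for `m ≡ -ip'` modulo `dq` and `m ≡ -ju'` modulo `dw`; this is their
  -- compatibility modulo `d`.
  obtain ⟨f, hf⟩ : d ∣ i * p' - j * u' := by
    refine hcop.dvd_of_dvd_mul_left ?_
    obtain ⟨e, he⟩ := h
    exact ⟨e - i * u * q' * q + j * p * w' * w, by
      linear_combination i * u * hp' - j * p * hu' + he⟩
  obtain ⟨x, y, hxy⟩ := hqw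
  have hm : -(i * p') + d * q * (x * f) = -(j * u') - d * w * (y * f) := by
    linear_combination d * f * hxy - hf
  -- A large multiple of both moduli makes the solution nonnegative.
  have hbig : 0 ≤ -(i * p') + d * q * (x * f) + d * q * (d * w) * |-(i * p') + d * q * (x * f)| := by
    have h1 : 1 ≤ d * q * (d * w) := hI.discrete.one_le (by positivity)
    have h2 := le_mul_of_one_le_left (abs_nonneg (-(i * p') + d * q * (x * f))) h1
    linarith [neg_abs_le (-(i * p') + d * q * (x * f))]
  generalize |-(i * p') + d * q * (x * f)| = K at hbig
  refine ⟨_, hbig, ⟨i * q' + x * f * p + d * w * K * p, ?_⟩,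
    ⟨j * w' - y * f * u + d * q * K * u, ?_⟩⟩
  · linear_combination -i * hp'
  · linear_combination u * hm - j * hu'

theorem exists_combination_eq_one_of_N_subset (hI : IsIntegerPart I) (hIE : ModelsIE1 I)
    {ρ σ : F} (hρ : IsRational I ρ) (hσ : IsRational I σ) (hρ1 : 1 < ρ) (hσ1 : 1 < σ)
    (hsub : N I ρ ⊆ N I σ) :
    ∃ a b : I, 0 ≤ a ∧ 0 ≤ b ∧ (a : F) * ρ⁻¹ + (b : F) * (1 - σ⁻¹) = 1 := by
  obtain ⟨p, q, hp, hq, hpq, rfl⟩ := hρ.exists_isCoprime hI hIE (one_pos.trans hρ1)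
  obtain ⟨v, w, hv, hw, hvw, rfl⟩ := hσ.exists_isCoprime hI hIE (one_pos.trans hσ1)
  have hp' : (0 : F) < p := by exact_mod_cast hp
  have hv' : (0 : F) < v := by exact_mod_cast hv
  have hu : 0 < w - v := by
    rw [one_lt_div hv'] at hσ1
    exact sub_pos.2 (by exact_mod_cast hσ1)
  have huw : IsCoprime (w - v) w := by
    obtain ⟨x, y, hxy⟩ := hvw
    exact ⟨-x, y + x, by linear_combination hxy⟩
  obtain ⟨d, q', w', hd, rfl, rfl, hcop⟩ := exists_gcd hI hIE q w
  have hq' : 0 < q' := pos_of_mul_pos_right hq hd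
  have hw' : 0 < w' := pos_of_mul_pos_right hw hd
  have hd' : 0 < d := pos_of_mul_pos_left hq hq'.le
  obtain ⟨a, b, ha, hb, hab⟩ | ⟨i, j, hi0, hip, hj1, hju, hij⟩ :=
    exists_nonneg_combination_or hI hIE hp hu hd'
  · refine ⟨q' * a, w' * b, mul_nonneg hq'.le ha, mul_nonneg hw'.le hb, ?_⟩
    have e1 : (q' : F) ≠ 0 := by exact_mod_cast hq'.ne'
    have e2 : (w' : F) ≠ 0 := by exact_mod_cast hw'.ne'
    have e3 : (d : F) ≠ 0 := by exact_mod_cast hd'.ne'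
    have hab' : (a : F) * p + b * (d * w' - v) = d := by exact_mod_cast hab
    push_cast
    rw [inv_div, inv_div]
    field_simp
    linear_combination hab'
  · exfalso
    obtain ⟨m, hm, ⟨n, hn⟩, k, hk⟩ := exists_nonneg_dvd_mul_add hI hd' hq' hw' hpq huw hcop hij
    have hmem : m ∈ N I (((d * q' : I) : F) / p) := by
      refine ⟨n, nonneg_of_mul_nonneg_right (hn ▸ by positivity) hq, ?_, ?_⟩
      · rw [mul_div_assoc', le_div_iff₀ hp']
        exact_mod_cast (by linarith : m * p ≤ n * (d * q'))
      · rw [mul_div_assoc', div_lt_iff₀ hp']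
        exact_mod_cast (by linarith : n * (d * q') < (m + 1) * p)
    obtain ⟨l, -, h1, h2⟩ := hsub hmem
    rw [mul_div_assoc', le_div_iff₀ hv'] at h1
    rw [mul_div_assoc', div_lt_iff₀ hv'] at h2
    have h1' : m * v ≤ l * (d * w') := by exact_mod_cast h1
    have h2' : l * (d * w') < (m + 1) * v := by exact_mod_cast h2
    -- Since `mv = (m - k)w + j` with `j ≥ 1`, the bound `lw ≥ mv` forces `l ≥ m - k + 1`. Then `lw
    -- ≥ mv - j + w ≥ (m + 1)v` because `j ≤ u = w - v`, a contradiction.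
    have h3 : m < l + k := lt_of_mul_lt_mul_right (a := d * w') (by linarith) hw.le
    have h4 := mul_le_mul_of_nonneg_right (hI.discrete.add_one_le h3) hw.le
    linarith

end Rational

end SkolemBang

end

theorem mainTheorem3 {F : Type*} [Field F] [LinearOrder F] [IsStrictOrderedRing F]
    (I : Subring F) (hI : SkolemBang.IsIntegerPart I) (hIE : SkolemBang.ModelsIE1 I) :
    -- Fact C
    (∀ α β : F, 0 < α → 0 < β →
      ¬ SkolemBang.IsRational I α → ¬ SkolemBang.IsRational I β →
      ∀ a b c : I, (a : F) * α⁻¹ + (b : F) * β⁻¹ = (c : F) → a * b < 0 → c ≠ 0 →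
        SkolemBang.IsCofinalNonneg I (SkolemBang.N I α ∩ SkolemBang.N I β)) ∧
    -- Fact D
    (∀ α β : F, 0 < α → 0 < β →
      ¬ SkolemBang.IsRational I α → ¬ SkolemBang.IsRational I β →
      ∀ a b c : I, (a : F) * α⁻¹ + (b : F) * β⁻¹ = (c : F) → 0 < a → 0 < b → 1 < c →
        SkolemBang.GcdEqOne a b c →
        SkolemBang.IsCofinalNonneg I (SkolemBang.N I α ∩ SkolemBang.N I β)) ∧
    -- Fact F'
    (∀ ρ σ : F, SkolemBang.IsRational I ρ → SkolemBang.IsRational I σ → 1 < ρ → 1 < σ →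
      SkolemBang.N I ρ ⊆ SkolemBang.N I σ →
        ∃ a b : I, 0 ≤ a ∧ 0 ≤ b ∧ (a : F) * ρ⁻¹ + (b : F) * (1 - σ⁻¹) = 1) := by
  refine ⟨fun α β hα hβ hαi hβi a b c h hab _ => ?_,
    fun α β hα hβ hαi _ a b c h ha hb hc hg =>
      SkolemBang.isCofinalNonneg_of_pos_of_pos hI hIE hα hβ hαi h ha hb hc hg,
    fun ρ σ hρ hσ hρ1 hσ1 hsub =>
      SkolemBang.exists_combination_eq_one_of_N_subset hI hIE hρ hσ hρ1 hσ1 hsub⟩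
  obtain ⟨ha, hb⟩ | ⟨ha, hb⟩ := mul_neg_iff.1 hab
  · exact SkolemBang.isCofinalNonneg_of_pos_of_neg hI hIE hα hβ hαi h ha hb
  · rw [Set.inter_comm]
    exact SkolemBang.isCofinalNonneg_of_pos_of_neg hI hIE hβ hα hβi ((add_comm _ _).trans h) hb ha
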